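/- Let $\mathbb F_q$ be a finite field, let $1\le \ell\le m$ be integers, and let $V$ be an $m$-dimensional vector space over $\mathbb F_q$ with a fixed basis $\mathcal B$. Let $G_\ell(V)$ be the Grassmannian of all $\ell$-dimensional subspaces of $V$. For each $P\in G_\ell(V)$ fix a basis of $P$, and let $M_P$ be the $\ell\times m$ matrix whose rows are the coordinates of the basis vectors of $P$ with respect to $\mathcal B$. The Plücker map sends $P$ to the point of projective space whose homogeneous coordinates are the $\ell\times\ell$ minors of $M_P$. Let $\alpha=(\alpha_1,\dots,\alpha_\ell)$ be integers with $1\le\alpha_1<\cdots<\alpha_\ell\le m$ and $\alpha\ne(1,2,\dots,\ell)$, let $A_1\subset\cdots\subset A_\ell$ be subspaces of $V$ with $\dim A_i=\alpha_i$, and let $$\Omega_\alpha(\ell,m)=\{P\in G_\ell(V):\ \dim(P\cap A_i)\ge i\ \text{ for } 1\le i\le \ell\}$$ be the corresponding Schubert variety. The Schubert code $C_\alpha(\ell,m)\subseteq\mathbb F_q^{\Omega_\alpha(\ell,m)}$ consists of all words $(f(M_P))_{P\in\Omega_\alpha(\ell,m)}$, where $f$ runs over the $\mathbb F_q$-linear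 span of the $\ell\times\ell$ minors of the $\ell\times m$ matrix of indeterminates. Let $C_\alpha(\ell,m)^\perp$ be its dual with respect to the standard dot product. For subspaces $U\subset W$ of $V$ of dimensions $\ell-1$ and $\ell+1$ put $$L(U,W)=\{P\in G_\ell(V):\ U\subset P\subset W\}.$$ **Theorem.** 1. The minimum distance of $C_\alpha(\ell,m)^\perp$ is $3$. 2. For every codeword $\omega\in C_\alpha(\ell,m)^\perp$ of Hamming weight $3$, the three points of its support lie on a line contained in $\Omega_\alpha(\ell,m)$: there are subspaces $U\subset W$ of $V$ of dimensions $\ell-1$ and $\ell+1$ such that $L(U,W)\subset\Omega_\alpha(\ell,m)$, the image of $L(U,W)$ under the Plücker map is a line of the projective space, and $\operatorname{supp}(\omega)\subset L(U,W)$. 3. Conversely, for all subspaces $U\subset W$ of $V$ of dimensions $\ell-1$ and $\ell+1$ with $L(U,W)\subset\Omega_\alpha(\ell,m)$ and any three distinct points $P,Q,R\in L(U,W)$, there is a codeword $\omega\in C_\alpha(\ell,m)^\perp$ with $\operatorname{supp}(\omega)=\{P,Q,R\}$. -/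

import Mathlib

namespace SchubertCode

open Module

/-- The Grassmannian `G_ℓ(V)`: all `ℓ`-dimensional linear subspaces of `V`. -/
abbrev Gr (F V : Type*) [Field F] [AddCommGroup V] [Module F V] (ℓ : ℕ) : Type _ :=
  {P : Submodule F V // finrank F P = ℓ}

/-- The Grassmannian of a finite-dimensional space over a finite field is finite. -/
noncomputable instance instFintypeGr {F V : Type*} [Field F] [Finite F] [AddCommGroup V]
    [Module F V] [FiniteDimensional F V] (ℓ : ℕ) : Fintype (Gr F V ℓ) :=
  haveI : Finite V := Module.finite_of_finite F
  Fintype.ofFinite _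

/-- Any set of points of the Grassmannian is finite. -/
noncomputable instance instFintypeGrSet {F V : Type*} [Field F] [Finite F] [AddCommGroup V]
    [Module F V] [FiniteDimensional F V] {ℓ : ℕ} (S : Set (Gr F V ℓ)) : Fintype S :=
  Fintype.ofFinite _

/-- `𝕀(ℓ, m)`: the integer tuples `1 ≤ α₁ < α₂ < ⋯ < α_ℓ ≤ m`; the entry `α i` for `i : Fin ℓ`
is `α_{i+1}` in the usual numbering that starts at one. -/
def indexSet (ℓ m : ℕ) : Set (Fin ℓ → ℕ) :=
  {α | StrictMono α ∧ ∀ i, 1 ≤ α i ∧ α i ≤ m}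

/-- `A₁ ⊂ A₂ ⊂ ⋯ ⊂ A_ℓ` is a partial flag of subspaces of dimension sequence `α`. -/
def IsPartialFlag {F V : Type*} [Field F] [AddCommGroup V] [Module F V] {ℓ : ℕ}
    (α : Fin ℓ → ℕ) (A : Fin ℓ → Submodule F V) : Prop :=
  Monotone A ∧ ∀ i, finrank F (A i) = α i

/-- The Schubert variety of the flag `A`: the `ℓ`-dimensional subspaces `P` with
`dim (P ∩ A_i) ≥ i` for `1 ≤ i ≤ ℓ`. -/
def schubertVariety {F V : Type*} [Field F] [AddCommGroup V] [Module F V] {ℓ : ℕ}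
    (A : Fin ℓ → Submodule F V) : Set (Gr F V ℓ) :=
  {P | ∀ i : Fin ℓ, (i : ℕ) + 1 ≤ finrank F (P.1 ⊓ A i : Submodule F V)}

/-- `L(U, W)`: the points `P` of the Grassmannian with `U ⊆ P ⊆ W`. -/
def lineSet {F V : Type*} [Field F] [AddCommGroup V] [Module F V] (ℓ : ℕ)
    (U W : Submodule F V) : Set (Gr F V ℓ) :=
  {P | U ≤ P.1 ∧ P.1 ≤ W}

/-- The `ℓ × m` matrix whose rows are the coordinates, with respect to the basis `B` of `V`, of the
vectors of a basis `e` of the subspace `P`. -/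
noncomputable def coordMatrix {F V : Type*} [Field F] [AddCommGroup V] [Module F V] {ℓ m : ℕ}
    (B : Basis (Fin m) F V) {P : Submodule F V} (e : Basis (Fin ℓ) F P) :
    Matrix (Fin ℓ) (Fin m) F :=
  Matrix.of fun i j => B.repr (e i : V) j

/-- The vector of all maximal minors of an `ℓ × m` matrix. The increasing tuples of column labels
are the order embeddings of `Fin ℓ` into `Fin m`. -/
def minors {R : Type*} [CommRing R] {ℓ m : ℕ} (M : Matrix (Fin ℓ) (Fin m) R) :
    (Fin ℓ ↪o Fin m) → R :=
  fun β => (M.submatrix id β).det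

theorem minors_coordMatrix_ne_zero {F V : Type*} [Field F] [AddCommGroup V] [Module F V] {ℓ m : ℕ}
    (B : Basis (Fin m) F V) {P : Submodule F V} (e : Basis (Fin ℓ) F P) :
    minors (coordMatrix B e) ≠ 0 := by
  classical
  set M := coordMatrix B e with hM
  have hrow : LinearIndependent F M.row := by
    have h1 : LinearIndependent F (fun i => (e i : V)) :=
      e.linearIndependent.map' P.subtype P.ker_subtype
    exact h1.map' B.equivFun.toLinearMap B.equivFun.ker
  have hspan : Submodule.span F (Set.range M.col) = ⊤ := by
    apply Submodule.eq_top_of_finrank_eq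
    rw [← Matrix.rank_eq_finrank_span_cols, hrow.rank_matrix]
    simp
  obtain ⟨κ, a, ha, hs, hli⟩ := exists_linearIndependent' F M.col
  have : Finite κ := Finite.of_injective a ha
  let _ : Fintype κ := Fintype.ofFinite κ
  have hcard : Fintype.card κ = ℓ := by
    have := finrank_span_eq_card hli
    rw [hs, hspan] at this
    simpa using this.symm
  let s : Finset (Fin m) := Finset.univ.image a
  have hsc : s.card = ℓ := by
    rw [Finset.card_image_of_injective _ ha, Finset.card_univ, hcard]
  let β : Fin ℓ ↪o Fin m := s.orderEmbOfFin hsc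
  intro h0
  have hdet : (M.submatrix id β).det = 0 := congrFun h0 β
  have hmem : ∀ i, ∃ k, a k = β i := fun i => by
    have h2 : β i ∈ Finset.univ.image a := s.orderEmbOfFin_mem hsc i
    obtain ⟨k, _, hk⟩ := Finset.mem_image.mp h2
    exact ⟨k, hk⟩
  choose g hg using hmem
  have hginj : Function.Injective g := fun i j hij => by
    apply β.injective
    rw [← hg i, ← hg j, hij]
  have hcol : LinearIndependent F (M.submatrix id β).col := by
    have h3 : (M.submatrix id β).col = (M.col ∘ a) ∘ g := by
      funext i
      simp only [Function.comp, hg]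
      rfl
    rw [h3]
    exact hli.comp g hginj
  have hu := Matrix.linearIndependent_cols_iff_isUnit.mp hcol
  rw [Matrix.isUnit_iff_isUnit_det, hdet] at hu
  exact not_isUnit_zero hu

/-- The Plücker map from the Grassmannian to projective space, with respect to the basis `B` of `V`,
computed with the chosen bases `b P` of the subspaces `P`. -/
noncomputable def plucker {F V : Type*} [Field F] [AddCommGroup V] [Module F V] {ℓ m : ℕ}
    (B : Basis (Fin m) F V) (b : (P : Gr F V ℓ) → Basis (Fin ℓ) F P.1) (P : Gr F V ℓ) :
    Projectivization F ((Fin ℓ ↪o Fin m) → F) :=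
  Projectivization.mk F (minors (coordMatrix B (b P))) (minors_coordMatrix_ne_zero B (b P))

/-- A line of a projective space: the points contained in a two-dimensional linear subspace. -/
def IsProjectiveLine {F E : Type*} [Field F] [AddCommGroup E] [Module F E]
    (S : Set (Projectivization F E)) : Prop :=
  ∃ T : Submodule F E, finrank F T = 2 ∧ S = {p | p.submodule ≤ T}

/-- The space spanned by all `ℓ × ℓ` minors of the generic `ℓ × m` matrix of indeterminates. -/
noncomputable def minorSpace (F : Type*) [Field F] (ℓ m : ℕ) :
    Submodule F (MvPolynomial (Fin ℓ × Fin m) F) :=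
  Submodule.span F (Set.range (minors (Matrix.mvPolynomialX (Fin ℓ) (Fin m) F)))

/-- The evaluation map, sending a polynomial `f` to the family of the values `f(M_P)`, where `P`
runs over the Grassmannian. -/
noncomputable def evalMap {F V : Type*} [Field F] [AddCommGroup V] [Module F V] {ℓ m : ℕ}
    (B : Basis (Fin m) F V) (b : (P : Gr F V ℓ) → Basis (Fin ℓ) F P.1) :
    MvPolynomial (Fin ℓ × Fin m) F →ₗ[F] (Gr F V ℓ → F) :=
  LinearMap.pi fun P =>
    (MvPolynomial.aeval fun ij : Fin ℓ × Fin m => coordMatrix B (b P) ij.1 ij.2).toLinearMap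

/-- The Grassmann code, with coordinates indexed by the points of the Grassmannian. -/
noncomputable def grassmannCode {F V : Type*} [Field F] [AddCommGroup V] [Module F V] {ℓ m : ℕ}
    (B : Basis (Fin m) F V) (b : (P : Gr F V ℓ) → Basis (Fin ℓ) F P.1) :
    Submodule F (Gr F V ℓ → F) :=
  (minorSpace F ℓ m).map (evalMap B b)

/-- The Schubert code: the Grassmann code punctured outside the Schubert variety of the flag `A`,
that is, restricted to the coordinates in that variety. -/
noncomputable def schubertCode {F V : Type*} [Field F] [AddCommGroup V] [Module F V] {ℓ m : ℕ}
    (B : Basis (Fin m) F V) (b : (P : Gr F V ℓ) → Basis (Fin ℓ) F P.1)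
    (A : Fin ℓ → Submodule F V) : Submodule F (schubertVariety A → F) :=
  (grassmannCode B b).map
    (LinearMap.funLeft F F (Subtype.val : schubertVariety A → Gr F V ℓ))

/-- The dual of a linear code with respect to the standard dot product. -/
def dualCode {F ι : Type*} [Field F] [Fintype ι] (C : Submodule F (ι → F)) :
    Submodule F (ι → F) where
  carrier := {w | ∀ c ∈ C, w ⬝ᵥ c = 0}
  zero_mem' := fun c _ => zero_dotProduct c
  add_mem' := fun {x y} hx hy c hc => by rw [add_dotProduct, hx c hc, hy c hc, add_zero]
  smul_mem' := fun r x hx c hc => by rw [smul_dotProduct, hx c hc, smul_zero]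

/-- The code `C` has minimum distance `d`: the least Hamming distance between two distinct codewords
exists and is `d`. -/
def HasMinDistance {F ι : Type*} [Field F] [DecidableEq F] [Fintype ι]
    (C : Submodule F (ι → F)) (d : ℕ) : Prop :=
  IsLeast {n | ∃ x ∈ C, ∃ y ∈ C, x ≠ y ∧ hammingDist x y = n} d

end SchubertCode

namespace SchubertCode

open Module

/-! ### Dual codewords as linear relations between Plücker vectors. -/

section Code

variable {F V : Type*} [Field F] [AddCommGroup V] [Module F V] {ℓ m : ℕ}

/-! A dual codeword is a linear relation between the Plücker vectors of the points of the Schubert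
variety. Everything rests on one separation principle (`exists_ne_disjoint_of_relation`): if S meets
P trivially, some alternating form is 1 on P and 0 on every Q meeting S, so a relation involving P
involves another point disjoint from S.

Taking S = 0 gives a second point Q, and S spanned by a vector of Q outside P gives a third; hence
the weight is at least 3. If the support is {P, Q, R}, a plane S spanned by x in R and y in Q,
disjoint from P, is impossible. So Q lies in P + ⟨x⟩ for every x in R outside P, which makes P and Q
adjacent. By the same principle R contains P ∩ Q and lies in P + Q. A dimension count keeps the
whole line inside the Schubert variety.

Conversely, the Plücker vector of U + ⟨x⟩ is linear in x with kernel U, so those of L(U, W) lie in a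
copy of W/U, a plane. Any three are dependent, and the weight bound makes all three coefficients
nonzero. Finally α ≠ (1, ..., ℓ) leaves room in the last flag member for such a line, so weight 3 is
attained. -/

/-- Evaluating a maximal minor of the generic matrix at a point of the Grassmannian. -/
theorem evalMap_minors (B : Basis (Fin m) F V) (b : (P : Gr F V ℓ) → Basis (Fin ℓ) F P.1)
    (β : Fin ℓ ↪o Fin m) (P : Gr F V ℓ) :
    evalMap B b (minors (Matrix.mvPolynomialX (Fin ℓ) (Fin m) F) β) P =
      minors (coordMatrix B (b P)) β := by
  simp only [evalMap, minors, LinearMap.pi_apply, AlgHom.toLinearMap_apply, AlgHom.map_det]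
  congr 1
  ext i j
  simp [Matrix.mvPolynomialX]

/-- The dual Schubert code consists of the linear relations between the Plücker vectors. -/
theorem mem_dualCode_schubertCode_iff [Finite F] [FiniteDimensional F V]
    (B : Basis (Fin m) F V) (b : (P : Gr F V ℓ) → Basis (Fin ℓ) F P.1)
    (A : Fin ℓ → Submodule F V) (ω : schubertVariety A → F) :
    ω ∈ dualCode (schubertCode B b A) ↔
      ∑ P : schubertVariety A, ω P • minors (coordMatrix B (b P.1)) = 0 := by
  have key : ∀ β, ω ⬝ᵥ LinearMap.funLeft F F (Subtype.val : schubertVariety A → Gr F V ℓ)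
      (evalMap B b (minors (Matrix.mvPolynomialX (Fin ℓ) (Fin m) F) β)) =
      (∑ P : schubertVariety A, ω P • minors (coordMatrix B (b P.1))) β := by
    intro β
    simp [dotProduct, LinearMap.funLeft_apply, evalMap_minors]
  constructor
  · intro h
    funext β
    rw [← key]
    exact h _ (Submodule.mem_map_of_mem (Submodule.mem_map_of_mem
      (Submodule.subset_span ⟨β, rfl⟩)))
  · rintro h _ ⟨_, ⟨f, hf, rfl⟩, rfl⟩
    induction hf using Submodule.span_induction with
    | mem x hx =>
      obtain ⟨β, rfl⟩ := hx
      rw [key, h]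
      rfl
    | zero => simp
    | add x y _ _ hx hy => rw [map_add, map_add, dotProduct_add, hx, hy, add_zero]
    | smul a x _ hx => rw [map_smul, map_smul, dotProduct_smul, hx, smul_zero]

/-- An alternating form which vanishes on the increasing families of basis vectors is zero. -/
theorem _root_.Module.Basis.ext_alternating_orderEmb {E : Type*} [AddCommGroup E] [Module F E]
    (e : Basis (Fin m) F E) (f : E [⋀^Fin ℓ]→ₗ[F] F)
    (h : ∀ β : Fin ℓ ↪o Fin m, f (fun i => e (β i)) = 0) : f = 0 := by
  refine Basis.ext_alternating e fun v hv => ?_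
  -- Sorting an injective family of indices changes the value only by a sign.
  have hs : StrictMono (v ∘ Tuple.sort v) :=
    (Tuple.monotone_sort v).strictMono_of_injective (hv.comp (Tuple.sort v).injective)
  have h0 := h (OrderEmbedding.ofStrictMono _ hs)
  have h1 := f.map_perm (fun i => e (v i)) (Tuple.sort v)
  have h2 : f ((fun i => e (v i)) ∘ Tuple.sort v) = 0 := h0
  rw [h2] at h1
  rcases Int.units_eq_one_or (Equiv.Perm.sign (Tuple.sort v)) with hε | hε <;>
    simpa [hε] using h1.symm

/-- The alternating form `φ ↦ det (φ i (v j))` on the dual space. -/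
noncomputable def dualForm (v : Fin ℓ → V) : Dual F V [⋀^Fin ℓ]→ₗ[F] F :=
  Matrix.detRowAlternating.compLinearMap (LinearMap.pi fun j => Dual.eval F V (v j))

theorem dualForm_apply (v : Fin ℓ → V) (φ : Fin ℓ → Dual F V) :
    dualForm v φ = (Matrix.of fun i j => φ i (v j)).det := rfl

/-- This lets a relation between vectors of minors be tested on arbitrary linear forms, not only on
coordinate forms of `B`. -/
theorem dualForm_coord (B : Basis (Fin m) F V) {P : Submodule F V} (e : Basis (Fin ℓ) F P)
    (β : Fin ℓ ↪o Fin m) :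
    dualForm (fun i => (e i : V)) (fun i => B.coord (β i)) = minors (coordMatrix B e) β := by
  rw [dualForm_apply, minors, ← Matrix.det_transpose]
  rfl

theorem sum_smul_alternatingMap_apply {ι E : Type*} [Fintype ι] [AddCommGroup E] [Module F E]
    (ω : ι → F) (f : ι → E [⋀^Fin ℓ]→ₗ[F] F) (v : Fin ℓ → E) :
    (∑ i, ω i • f i) v = ∑ i, ω i * f i v := by
  let ev : (E [⋀^Fin ℓ]→ₗ[F] F) →+ F := ⟨⟨fun g => g v, rfl⟩, fun _ _ => rfl⟩
  exact map_sum ev (fun i => ω i • f i) Finset.univ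

/-- A relation between Plücker vectors holds for all families of linear forms. -/
theorem sum_smul_dualForm_eq_zero {ι : Type*} [Fintype ι] (B : Basis (Fin m) F V)
    (P : ι → Submodule F V) (e : ∀ i, Basis (Fin ℓ) F (P i)) (ω : ι → F)
    (h : ∑ i, ω i • minors (coordMatrix B (e i)) = 0) :
    ∑ i, ω i • dualForm (F := F) (fun j => (e i j : V)) = 0 := by
  classical
  refine B.dualBasis.ext_alternating_orderEmb _ fun β => ?_
  have h1 := congrFun h β
  rw [sum_smul_alternatingMap_apply]
  simpa [Finset.sum_apply, dualForm_coord] using h1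

/-- Linear forms dual to a basis of `P` and vanishing on a subspace `S` disjoint from `P`. -/
theorem exists_dualForm_eq_one {P S : Submodule F V} (e : Basis (Fin ℓ) F P)
    (h : Disjoint P S) :
    ∃ φ : Fin ℓ → Dual F V, dualForm (fun j => (e j : V)) φ = 1 ∧
      ∀ (Q : Submodule F V) (e' : Basis (Fin ℓ) F Q), ¬ Disjoint Q S →
        dualForm (fun j => (e' j : V)) φ = 0 := by
  -- Enlarge S to a complement S' of P. The coordinates of the projection onto P along S' are dual
  -- to the basis of P and kill S.
  obtain ⟨S', hS', hc⟩ := h.symm.exists_isCompl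
  refine ⟨fun i => e.coord i ∘ₗ Submodule.projectionOnto P S' hc.symm, ?_, ?_⟩
  · rw [dualForm_apply]
    rw [← Matrix.det_one (n := Fin ℓ)]
    congr 1
    ext i j
    simp [Matrix.one_apply, Finsupp.single_apply, eq_comm]
  · intro Q e' hQ
    obtain ⟨x, hxQ, hxS, hx0⟩ : ∃ x ∈ Q, x ∈ S ∧ x ≠ 0 := by
      simpa [Submodule.disjoint_def] using hQ
    rw [dualForm_apply]
    -- The coordinates of a nonzero x in Q ∩ S form a kernel vector of the matrix.
    refine Matrix.exists_mulVec_eq_zero_iff.mp ⟨e'.repr ⟨x, hxQ⟩, ?_, ?_⟩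
    · intro h0
      apply hx0
      have : e'.repr ⟨x, hxQ⟩ = 0 := by
        ext i
        exact congrFun h0 i
      simpa using this
    · ext i
      have hsum : ∑ j, e'.repr ⟨x, hxQ⟩ j • (e' j : V) = x := by
        simpa [-Basis.sum_repr] using congrArg Subtype.val (e'.sum_repr ⟨x, hxQ⟩)
      have hpx : Submodule.projectionOnto P S' hc.symm x = 0 :=
        (Submodule.projectionOnto_apply_eq_zero_iff hc.symm).mpr (hS' hxS)
      have h2 := congrArg (e.coord i ∘ₗ Submodule.projectionOnto P S' hc.symm) hsum
      rw [LinearMap.comp_apply _ _ x, hpx, map_zero, map_sum] at h2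
      simpa [Matrix.mulVec, dotProduct, mul_comm] using h2

/-- If `P` takes part in a relation between Plücker vectors and `S` is disjoint from `P`, then some
other subspace taking part in the relation is disjoint from `S`. -/
theorem exists_ne_disjoint_of_relation {ι : Type*} [Fintype ι] (B : Basis (Fin m) F V)
    (P : ι → Submodule F V) (e : ∀ i, Basis (Fin ℓ) F (P i)) (ω : ι → F)
    (h : ∑ i, ω i • minors (coordMatrix B (e i)) = 0) {i : ι} (hi : ω i ≠ 0)
    {S : Submodule F V} (hS : Disjoint (P i) S) :
    ∃ j, j ≠ i ∧ ω j ≠ 0 ∧ Disjoint (P j) S := by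
  by_contra! hcon
  obtain ⟨φ, hφ, hφ'⟩ := exists_dualForm_eq_one (e i) hS
  have h1 := congrArg (fun f => f φ) (sum_smul_dualForm_eq_zero B P e ω h)
  simp only [sum_smul_alternatingMap_apply, AlternatingMap.zero_apply] at h1
  rw [Finset.sum_eq_single i] at h1
  · rw [hφ] at h1
    exact hi (by simpa using h1)
  · intro j _ hj
    by_cases hω : ω j = 0
    · simp [hω]
    · rw [hφ' _ (e j) (hcon j hj hω), mul_zero]
  · simp

end Code

/-! ### Test subspaces and flags. -/

section Subspaces

variable {F V : Type*} [Field F] [AddCommGroup V] [Module F V]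

theorem _root_.Submodule.disjoint_span_pair {P : Submodule F V} {x y : V}
    (hx : x ∉ P) (hy : y ∉ P ⊔ F ∙ x) : Disjoint P (Submodule.span F {x, y}) := by
  rw [Submodule.disjoint_def]
  intro z hzP hz
  obtain ⟨a, c, rfl⟩ := Submodule.mem_span_pair.mp hz
  have hc : c = 0 := by
    by_contra hc
    apply hy
    have h1 : c • y ∈ P ⊔ F ∙ x := by
      have h2 : c • y = (a • x + c • y) + (-a) • x := by module
      rw [h2]
      exact Submodule.add_mem_sup hzP
        (Submodule.smul_mem _ _ (Submodule.mem_span_singleton_self x))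
    exact (Submodule.smul_mem_iff _ hc).mp h1
  subst hc
  by_cases ha : a = 0
  · simp [ha]
  · exact absurd ((Submodule.smul_mem_iff _ ha).mp (by simpa using hzP)) hx

theorem exists_mem_notMem_of_finrank_lt [FiniteDimensional F V] {P Q : Submodule F V}
    (h : finrank F P < finrank F Q) : ∃ x ∈ Q, x ∉ P := by
  by_contra! hc
  exact absurd (Submodule.finrank_mono (show Q ≤ P from hc)) (by omega)

theorem Gr.exists_mem_notMem [FiniteDimensional F V] {ℓ : ℕ} {P Q : Gr F V ℓ} (h : P ≠ Q) :
    ∃ x ∈ Q.1, x ∉ P.1 := by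
  by_contra! hc
  refine h (Subtype.ext (Submodule.eq_of_le_of_finrank_eq (show Q.1 ≤ P.1 from hc) ?_).symm)
  rw [P.2, Q.2]

/-- Subspaces of prescribed dimension in general position below a flag. -/
theorem exists_le_flag [FiniteDimensional F V] (n : ℕ) (A : Fin n → Submodule F V)
    (hA : Monotone A) (hd : ∀ i : Fin n, (i : ℕ) + 1 ≤ finrank F (A i)) (T : Submodule F V)
    (hT : ∀ i, A i ≤ T) :
    ∃ U : Submodule F V, U ≤ T ∧ finrank F U = n ∧
      ∀ i : Fin n, (i : ℕ) + 1 ≤ finrank F (U ⊓ A i : Submodule F V) := by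
  induction n generalizing T with
  | zero => exact ⟨⊥, bot_le, by simp, fun i => i.elim0⟩
  | succ n ih =>
    -- The bound T is generalized so that U can be kept inside the last member of the flag, where
    -- one more vector is added.
    obtain ⟨U, hU, hUn, hUi⟩ := ih (fun i => A i.castSucc)
      (fun i j hij => hA (by simpa using hij)) (fun i => hd i.castSucc) (A (Fin.last n))
      (fun i => hA (Fin.le_last _))
    obtain ⟨x, hx, hxU⟩ := exists_mem_notMem_of_finrank_lt (P := U) (Q := A (Fin.last n))
      (by have := hd (Fin.last n); simp at this; omega)
    have hle : U ⊔ F ∙ x ≤ A (Fin.last n) :=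
      sup_le hU ((Submodule.span_singleton_le_iff_mem _ _).mpr hx)
    have hr : finrank F (U ⊔ F ∙ x : Submodule F V) = n + 1 := by
      rw [Submodule.finrank_sup_span_singleton hxU, hUn]
    refine ⟨U ⊔ F ∙ x, hle.trans (hT _), hr, fun i => ?_⟩
    induction i using Fin.lastCases with
    | last => rw [inf_eq_left.mpr hle, hr]; simp
    | cast i => exact (hUi i).trans (Submodule.finrank_mono (inf_le_inf_right _ le_sup_left))

end Subspaces

/-! ### Lines of the Grassmannian under the Plücker map. -/

section Line

variable {F V : Type*} [Field F] [AddCommGroup V] [Module F V] {ℓ m : ℕ}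

/-- The vector of all maximal minors of the coordinate matrix, as an alternating map. -/
noncomputable def minorsAlternating (B : Basis (Fin m) F V) (ℓ : ℕ) :
    V [⋀^Fin ℓ]→ₗ[F] ((Fin ℓ ↪o Fin m) → F) :=
  AlternatingMap.pi fun β =>
    Matrix.detRowAlternating.compLinearMap (LinearMap.pi fun j => B.coord (β j))

theorem minors_coordMatrix (B : Basis (Fin m) F V) {P : Submodule F V} (e : Basis (Fin ℓ) F P) :
    minors (coordMatrix B e) = minorsAlternating B ℓ fun i => (e i : V) := rfl

/-- Alternating forms of top degree on P are multiples of the determinant, so a change of basis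
multiplies all minors by one nonzero factor. -/
theorem exists_minorsAlternating_eq_smul (B : Basis (Fin m) F V) {P : Submodule F V}
    (e : Basis (Fin ℓ) F P) {v : Fin ℓ → V} (hv : LinearIndependent F v) (hP : ∀ i, v i ∈ P) :
    ∃ c : F, c ≠ 0 ∧ minorsAlternating B ℓ v = c • minors (coordMatrix B e) := by
  have : FiniteDimensional F P := Module.Finite.of_basis e
  let w : Fin ℓ → P := fun i => ⟨v i, hP i⟩
  have hw : LinearIndependent F w := LinearIndependent.of_comp P.subtype hv
  have hspan : Submodule.span F (Set.range w) = ⊤ :=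
    hw.span_eq_top_of_card_eq_finrank' (by rw [finrank_eq_card_basis e])
  refine ⟨e.det w, ((Basis.is_basis_iff_det e).mp ⟨hw, hspan⟩).ne_zero, ?_⟩
  funext β
  have h := congrArg (fun f => f w) (AlternatingMap.eq_smul_basis_det e
    ((Matrix.detRowAlternating.compLinearMap
      (LinearMap.pi fun j => B.coord (β j))).compLinearMap P.subtype))
  rw [AlternatingMap.smul_apply, smul_eq_mul, mul_comm] at h
  exact h

/-- The Plücker vectors of the subspaces spanned by a fixed family and one more vector. -/
noncomputable def lineMap {k : ℕ} (B : Basis (Fin m) F V) (u : Fin k → V) :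
    V →ₗ[F] ((Fin (k + 1) ↪o Fin m) → F) where
  toFun x := minorsAlternating B (k + 1) (Fin.cons x u)
  map_add' x y := congrArg (fun f => f u) ((minorsAlternating B (k + 1)).curryLeft.map_add x y)
  map_smul' a x := congrArg (fun f => f u) ((minorsAlternating B (k + 1)).curryLeft.map_smul a x)

variable {k : ℕ} {U : Submodule F V}

theorem linearIndependent_cons_of_notMem (u : Basis (Fin k) F U) {x : V} (hx : x ∉ U) :
    LinearIndependent F (Fin.cons x (fun i => (u i : V)) : Fin (k + 1) → V) := by
  refine linearIndependent_finCons.mpr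
    ⟨u.linearIndependent.map' U.subtype U.ker_subtype, fun h => hx ?_⟩
  refine Submodule.span_le.mpr ?_ h
  rintro _ ⟨i, rfl⟩
  exact (u i).2

theorem exists_lineMap_eq_smul (B : Basis (Fin m) F V) (u : Basis (Fin k) F U)
    {P : Submodule F V} (e : Basis (Fin (k + 1)) F P) (hUP : U ≤ P) {x : V} (hxP : x ∈ P)
    (hx : x ∉ U) :
    ∃ c : F, c ≠ 0 ∧ lineMap B (fun i => (u i : V)) x = c • minors (coordMatrix B e) :=
  exists_minorsAlternating_eq_smul B e (linearIndependent_cons_of_notMem u hx)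
    (Fin.cases hxP fun i => hUP (u i).2)

theorem lineMap_eq_zero_iff [FiniteDimensional F V] (B : Basis (Fin m) F V)
    (u : Basis (Fin k) F U) (x : V) : lineMap B (fun i => (u i : V)) x = 0 ↔ x ∈ U := by
  constructor
  · intro h
    by_contra hx
    have hr : finrank F (U ⊔ F ∙ x : Submodule F V) = k + 1 := by
      rw [Submodule.finrank_sup_span_singleton hx, finrank_eq_card_basis u, Fintype.card_fin]
    obtain ⟨c, hc, hcx⟩ := exists_lineMap_eq_smul B u (finBasisOfFinrankEq F _ hr)
      le_sup_left (le_sup_right (a := U) (Submodule.mem_span_singleton_self x)) hx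
    rw [hcx] at h
    exact (smul_ne_zero hc (minors_coordMatrix_ne_zero B _)) h
  · intro hx
    refine (minorsAlternating B (k + 1)).map_linearDependent _ fun h => ?_
    refine (linearIndependent_finCons.mp h).2 ?_
    have hspan : Submodule.span F (Set.range fun i => (u i : V)) = U := by
      have h1 := congrArg (Submodule.map U.subtype) u.span_eq
      rw [Submodule.map_span, Submodule.map_subtype_top, ← Set.range_comp] at h1
      exact h1
    rwa [hspan]

/-- Rank-nullity: the kernel is U, so the image of W is a copy of W/U. -/
theorem finrank_map_lineMap [FiniteDimensional F V] (B : Basis (Fin m) F V)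
    (u : Basis (Fin k) F U) {W : Submodule F V} (hUW : U ≤ W) :
    finrank F (W.map (lineMap B fun i => (u i : V))) + k = finrank F W := by
  have h := LinearMap.finrank_range_add_finrank_ker
    ((lineMap B fun i => (u i : V)).domRestrict W)
  have hk : LinearMap.ker ((lineMap B fun i => (u i : V)).domRestrict W) =
      U.comap W.subtype := by
    ext x
    exact lineMap_eq_zero_iff B u x
  rw [hk, LinearMap.range_domRestrict, (Submodule.comapSubtypeEquivOfLe hUW).finrank_eq,
    finrank_eq_card_basis u, Fintype.card_fin] at h
  exact h

theorem minors_mem_map_lineMap [FiniteDimensional F V] (B : Basis (Fin m) F V)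
    (u : Basis (Fin k) F U) {W P : Submodule F V} (e : Basis (Fin (k + 1)) F P)
    (hUP : U ≤ P) (hPW : P ≤ W) :
    minors (coordMatrix B e) ∈ W.map (lineMap B fun i => (u i : V)) := by
  obtain ⟨x, hxP, hx⟩ := exists_mem_notMem_of_finrank_lt (P := U) (Q := P)
    (by simp [finrank_eq_card_basis u, finrank_eq_card_basis e])
  obtain ⟨c, hc, h⟩ := exists_lineMap_eq_smul B u e hUP hxP hx
  rw [← Submodule.smul_mem_iff _ hc, ← h]
  exact Submodule.mem_map_of_mem (hPW hxP)

/-- The Plücker vectors of the points of `L(U, W)` lie in a two-dimensional space. -/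
theorem exists_finrank_eq_two_minors_mem [FiniteDimensional F V] (B : Basis (Fin m) F V)
    (b : (P : Gr F V ℓ) → Basis (Fin ℓ) F P.1) {W : Submodule F V} (hUW : U ≤ W)
    (hU : finrank F U + 1 = ℓ) (hW : finrank F W = ℓ + 1) :
    ∃ T : Submodule F ((Fin ℓ ↪o Fin m) → F), finrank F T = 2 ∧
      (∀ P ∈ lineSet ℓ U W, minors (coordMatrix B (b P)) ∈ T) ∧
      ∀ v ∈ T, v ≠ 0 →
        ∃ P ∈ lineSet ℓ U W, ∃ c : F, c ≠ 0 ∧ v = c • minors (coordMatrix B (b P)) := by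
  subst hU
  let u := finBasis F U
  refine ⟨W.map (lineMap B fun i => (u i : V)), ?_, ?_, ?_⟩
  · have := finrank_map_lineMap B u hUW
    omega
  · exact fun P hP => minors_mem_map_lineMap B u (b P) hP.1 hP.2
  · rintro _ ⟨x, hx, rfl⟩ hx0
    have hxU : x ∉ U := fun h => hx0 ((lineMap_eq_zero_iff B u x).mpr h)
    let P : Gr F V (finrank F U + 1) :=
      ⟨U ⊔ F ∙ x, Submodule.finrank_sup_span_singleton hxU⟩
    exact ⟨P, ⟨le_sup_left, sup_le hUW ((Submodule.span_singleton_le_iff_mem _ _).mpr hx)⟩,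
      exists_lineMap_eq_smul B u (b P) le_sup_left
        (le_sup_right (a := U) (Submodule.mem_span_singleton_self x)) hxU⟩

/-- The Plücker map sends `L(U, W)` onto a line. -/
theorem isProjectiveLine_image_lineSet [FiniteDimensional F V] (B : Basis (Fin m) F V)
    (b : (P : Gr F V ℓ) → Basis (Fin ℓ) F P.1) {W : Submodule F V} (hUW : U ≤ W)
    (hU : finrank F U + 1 = ℓ) (hW : finrank F W = ℓ + 1) :
    IsProjectiveLine (plucker B b '' lineSet ℓ U W) := by
  obtain ⟨T, hT, hmem, hex⟩ := exists_finrank_eq_two_minors_mem B b hUW hU hW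
  refine ⟨T, hT, Set.Subset.antisymm ?_ ?_⟩
  · rintro _ ⟨P, hP, rfl⟩
    simpa [plucker, Projectivization.submodule_mk] using hmem P hP
  · intro p hp
    induction p using Projectivization.ind with
    | h v hv =>
      have hvT : v ∈ T := by simpa [Projectivization.submodule_mk] using hp
      obtain ⟨P, hP, c, hc, h⟩ := hex v hvT hv
      exact ⟨P, hP, (Projectivization.mk_eq_mk_iff' F _ _ _ _).mpr
        ⟨c⁻¹, by rw [h, inv_smul_smul₀ hc]⟩⟩

/-- A line with two points in a Schubert variety is contained in it. -/
theorem lineSet_subset_schubertVariety [FiniteDimensional F V] (A : Fin ℓ → Submodule F V)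
    {W : Submodule F V} (hW : finrank F W = ℓ + 1) {P Q : Gr F V ℓ}
    (hP : P ∈ lineSet ℓ U W) (hQ : Q ∈ lineSet ℓ U W) (hPQ : P.1 ⊓ Q.1 = U)
    (hPA : P ∈ schubertVariety A) (hQA : Q ∈ schubertVariety A) :
    lineSet ℓ U W ⊆ schubertVariety A := by
  intro R hR i
  by_cases hi : (i : ℕ) + 1 ≤ finrank F (U ⊓ A i : Submodule F V)
  · exact hi.trans (Submodule.finrank_mono (inf_le_inf_right _ hR.1))
  -- With i counted from one, dim (U ∩ A_i) ≤ i - 1 here, so P ∩ A_i and Q ∩ A_i span at least i + 1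
  -- dimensions of W ∩ A_i. The hyperplane R of W loses at most one of them.
  have h1 := Submodule.finrank_sup_add_finrank_inf_eq (P.1 ⊓ A i) (Q.1 ⊓ A i)
  rw [← inf_inf_distrib_right, hPQ] at h1
  have h2 : finrank F (P.1 ⊓ A i ⊔ Q.1 ⊓ A i : Submodule F V) ≤
      finrank F (W ⊓ A i : Submodule F V) :=
    Submodule.finrank_mono (sup_le (inf_le_inf_right _ hP.2) (inf_le_inf_right _ hQ.2))
  have h3 := Submodule.finrank_sup_add_finrank_inf_eq R.1 (W ⊓ A i)
  rw [← inf_assoc, inf_eq_left.mpr hR.2, R.2] at h3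
  have h4 : finrank F (R.1 ⊔ W ⊓ A i : Submodule F V) ≤ finrank F W :=
    Submodule.finrank_mono (sup_le hR.2 inf_le_left)
  have h5 := hPA i
  have h6 := hQA i
  omega

end Line

/-! ### Dual codewords of small weight. -/

section Weight

variable {F V : Type*} [Field F] [Finite F] [AddCommGroup V] [Module F V]
  [FiniteDimensional F V] {ℓ m : ℕ}

theorem exists_ne_disjoint_of_mem_dualCode (B : Basis (Fin m) F V)
    (b : (P : Gr F V ℓ) → Basis (Fin ℓ) F P.1) (A : Fin ℓ → Submodule F V)
    {ω : schubertVariety A → F} (h : ω ∈ dualCode (schubertCode B b A))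
    {P : schubertVariety A} (hP : ω P ≠ 0) {S : Submodule F V} (hS : Disjoint P.1.1 S) :
    ∃ Q, Q ≠ P ∧ ω Q ≠ 0 ∧ Disjoint Q.1.1 S :=
  exists_ne_disjoint_of_relation B (fun P : schubertVariety A => P.1.1) (fun P => b P.1) ω
    ((mem_dualCode_schubertCode_iff B b A ω).mp h) hP hS

/-- Every nonzero dual codeword has weight at least three. -/
theorem three_le_hammingNorm [DecidableEq F] (B : Basis (Fin m) F V)
    (b : (P : Gr F V ℓ) → Basis (Fin ℓ) F P.1) (A : Fin ℓ → Submodule F V)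
    {ω : schubertVariety A → F} (h : ω ∈ dualCode (schubertCode B b A)) (h0 : ω ≠ 0) :
    3 ≤ hammingNorm ω := by
  obtain ⟨P, hP⟩ := Function.ne_iff.mp h0
  obtain ⟨Q, hQP, hQ, -⟩ := exists_ne_disjoint_of_mem_dualCode B b A h hP disjoint_bot_right
  obtain ⟨x, hxQ, hxP⟩ := Gr.exists_mem_notMem (fun h => hQP (Subtype.ext h.symm))
  -- The line spanned by x meets Q, so the point found here is neither P nor Q.
  obtain ⟨R, hRP, hR, hRx⟩ := exists_ne_disjoint_of_mem_dualCode B b A h hP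
    (Submodule.disjoint_span_singleton_of_notMem hxP)
  have hQR : Q ≠ R := by
    rintro rfl
    have hx0 := Submodule.disjoint_def.mp hRx x hxQ (Submodule.mem_span_singleton_self x)
    exact hxP (hx0 ▸ P.1.1.zero_mem)
  exact Finset.two_lt_card.mpr ⟨P, by simpa using hP, Q, by simpa using hQ, R, by simpa using hR,
    hQP.symm, hRP.symm, hQR⟩

/-- The three points in the support of a dual codeword of weight three lie on a line. -/
theorem exists_line_of_support_eq (B : Basis (Fin m) F V)
    (b : (P : Gr F V ℓ) → Basis (Fin ℓ) F P.1) (A : Fin ℓ → Submodule F V)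
    {ω : schubertVariety A → F} (h : ω ∈ dualCode (schubertCode B b A))
    {P Q R : schubertVariety A} (hPQ : P ≠ Q) (hPR : P ≠ R) (hQR : Q ≠ R)
    (hω : ∀ X, ω X ≠ 0 ↔ X = P ∨ X = Q ∨ X = R) :
    finrank F (P.1.1 ⊓ Q.1.1 : Submodule F V) + 1 = ℓ ∧
      finrank F (P.1.1 ⊔ Q.1.1 : Submodule F V) = ℓ + 1 ∧
      R.1 ∈ lineSet ℓ (P.1.1 ⊓ Q.1.1) (P.1.1 ⊔ Q.1.1) := by
  have key : ∀ {X Y Z : schubertVariety A}, X ≠ Y → X ≠ Z →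
      (∀ T, ω T ≠ 0 ↔ T = X ∨ T = Y ∨ T = Z) → ∀ {x : V}, x ∈ Z.1.1 → x ∉ X.1.1 →
      Y.1.1 ≤ X.1.1 ⊔ F ∙ x := by
    intro X Y Z hXY hXZ hωX x hxZ hxX y hyY
    -- Otherwise x and y span a plane disjoint from X that meets both other points of the support.
    by_contra hy
    have hyX : y ∉ X.1.1 := fun h => hy (Submodule.mem_sup_left h)
    obtain ⟨T, hTX, hT, hTd⟩ := exists_ne_disjoint_of_mem_dualCode B b A h
      ((hωX X).mpr (Or.inl rfl)) (Submodule.disjoint_span_pair hxX hy)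
    rw [Submodule.disjoint_def] at hTd
    rcases (hωX T).mp hT with rfl | rfl | rfl
    · exact hTX rfl
    · have := hTd y hyY (Submodule.subset_span (by simp))
      exact hyX (this ▸ X.1.1.zero_mem)
    · have := hTd x hxZ (Submodule.subset_span (by simp))
      exact hxX (this ▸ X.1.1.zero_mem)
  obtain ⟨x, hxR, hxP⟩ := Gr.exists_mem_notMem (fun h => hPR (Subtype.ext h))
  obtain ⟨y, hyQ, hyP⟩ := Gr.exists_mem_notMem (fun h => hPQ (Subtype.ext h))
  have hle : P.1.1 ⊔ Q.1.1 ≤ P.1.1 ⊔ F ∙ x := sup_le le_sup_left (key hPQ hPR hω hxR hxP)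
  have h1 := Submodule.finrank_mono hle
  rw [Submodule.finrank_sup_span_singleton hxP, P.1.2] at h1
  have hge : P.1.1 ⊔ F ∙ y ≤ P.1.1 ⊔ Q.1.1 :=
    sup_le_sup_left ((Submodule.span_singleton_le_iff_mem _ _).mpr hyQ) _
  have h2 := Submodule.finrank_mono hge
  rw [Submodule.finrank_sup_span_singleton hyP, P.1.2] at h2
  have h3 := Submodule.finrank_sup_add_finrank_inf_eq P.1.1 Q.1.1
  rw [P.1.2, Q.1.2] at h3
  refine ⟨by omega, by omega, ?_, ?_⟩
  · rintro z ⟨hzP, hzQ⟩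
    by_contra hzR
    obtain ⟨T, hTR, hT, hTd⟩ := exists_ne_disjoint_of_mem_dualCode B b A h
      ((hω R).mpr (Or.inr (Or.inr rfl))) (Submodule.disjoint_span_singleton_of_notMem hzR)
    have hzT : z ∈ T.1.1 := by
      rcases (hω T).mp hT with rfl | rfl | rfl
      · exact hzP
      · exact hzQ
      · exact absurd rfl hTR
    have hz0 := Submodule.disjoint_def.mp hTd z hzT (Submodule.mem_span_singleton_self z)
    exact hzR (hz0 ▸ R.1.1.zero_mem)
  · exact (key hPR hPQ (fun T => by rw [hω T, or_comm (a := T = Q)]) hyQ hyP).trans hge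

/-- Three points of a line in the Schubert variety support a dual codeword. -/
theorem exists_mem_dualCode_support_eq (B : Basis (Fin m) F V)
    (b : (P : Gr F V ℓ) → Basis (Fin ℓ) F P.1) (A : Fin ℓ → Submodule F V)
    {U W : Submodule F V} (hUW : U ≤ W) (hU : finrank F U + 1 = ℓ) (hW : finrank F W = ℓ + 1)
    {P Q R : schubertVariety A} (hP : P.1 ∈ lineSet ℓ U W) (hQ : Q.1 ∈ lineSet ℓ U W)
    (hR : R.1 ∈ lineSet ℓ U W) (hPQ : P ≠ Q) (hPR : P ≠ R) (hQR : Q ≠ R) :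
    ∃ ω ∈ dualCode (schubertCode B b A), Function.support ω = {P, Q, R} := by
  classical
  obtain ⟨T, hT, hmem, -⟩ := exists_finrank_eq_two_minors_mem B b hUW hU hW
  let s : Finset (schubertVariety A) := {P, Q, R}
  have hs : s.card = 3 := Finset.card_eq_three.mpr ⟨P, Q, R, hPQ, hPR, hQR, rfl⟩
  have hsT : ∀ X ∈ s, minors (coordMatrix B (b X.1)) ∈ T := by
    intro X hX
    have : X = P ∨ X = Q ∨ X = R := by simpa [s] using hX
    rcases this with rfl | rfl | rfl
    exacts [hmem _ hP, hmem _ hQ, hmem _ hR]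
  have hdep : ¬ LinearIndepOn F (fun X : schubertVariety A => minors (coordMatrix B (b X.1)))
      (s : Set (schubertVariety A)) := by
    intro hli
    let w : s → T := fun X => ⟨minors (coordMatrix B (b X.1.1)), hsT X.1 X.2⟩
    have hw : LinearIndependent F w := LinearIndependent.of_comp T.subtype hli
    have := hw.fintype_card_le_finrank
    rw [Fintype.card_coe, hs, hT] at this
    omega
  obtain ⟨f, hf, X, hX, hfX⟩ := not_linearIndepOn_finset_iff.mp hdep
  let ω : schubertVariety A → F := fun X => if X ∈ s then f X else 0
  have hω : ω ∈ dualCode (schubertCode B b A) := by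
    rw [mem_dualCode_schubertCode_iff, ← hf]
    simp [ω, ite_smul, Finset.sum_ite_mem]
  have hω0 : ω ≠ 0 := fun h => hfX (by simpa [ω, hX] using congrFun h X)
  have h3 := three_le_hammingNorm B b A hω hω0
  have hsub : Finset.univ.filter (fun X => ω X ≠ 0) ⊆ s := by
    intro X hX
    by_contra hXs
    simp [ω, hXs] at hX
  -- The support lies in a set of three points and has at least three elements, so no coefficient
  -- vanishes.
  have heq := Finset.eq_of_subset_of_card_le hsub (by rw [hs]; exact h3)
  refine ⟨ω, hω, ?_⟩
  ext X
  have := Finset.ext_iff.mp heq X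
  simpa [s] using this

end Weight

/-! ### A line inside the Schubert variety. -/

section Existence

variable {F V : Type*} [Field F] [AddCommGroup V] [Module F V] [FiniteDimensional F V] {ℓ m : ℕ}

/-- A line of the Grassmannian has three distinct points. -/
theorem exists_three_mem_lineSet {U W : Submodule F V} (hUW : U ≤ W)
    (hU : finrank F U + 1 = ℓ) (hW : finrank F W = ℓ + 1) :
    ∃ P ∈ lineSet ℓ U W, ∃ Q ∈ lineSet ℓ U W, ∃ R ∈ lineSet ℓ U W,
      P ≠ Q ∧ P ≠ R ∧ Q ≠ R := by
  obtain ⟨x, hxW, hxU⟩ := exists_mem_notMem_of_finrank_lt (P := U) (Q := W) (by omega)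
  have hx := Submodule.finrank_sup_span_singleton hxU
  obtain ⟨y, hyW, hyx⟩ := exists_mem_notMem_of_finrank_lt (P := U ⊔ F ∙ x) (Q := W) (by omega)
  have hself : ∀ z : V, z ∈ U ⊔ F ∙ z := fun z =>
    Submodule.mem_sup_right (Submodule.mem_span_singleton_self z)
  have hmem : ∀ {z : V} (hz : z ∉ U), z ∈ W → (⟨U ⊔ F ∙ z, by
      rw [Submodule.finrank_sup_span_singleton hz, hU]⟩ : Gr F V ℓ) ∈ lineSet ℓ U W :=
    fun _ hzW => ⟨le_sup_left, sup_le hUW ((Submodule.span_singleton_le_iff_mem _ _).mpr hzW)⟩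
  have hyU : y ∉ U := fun h => hyx (Submodule.mem_sup_left h)
  -- The vectors x, y and x + y give three points over any field, including the one with two
  -- elements.
  have hxy : x + y ∉ U ⊔ F ∙ x := fun h =>
    hyx ((Submodule.add_mem_iff_right _ (hself x)).mp h)
  have hxyU : x + y ∉ U := fun h => hxy (Submodule.mem_sup_left h)
  refine ⟨_, hmem hxU hxW, _, hmem hyU hyW, _, hmem hxyU (W.add_mem hxW hyW), ?_, ?_, ?_⟩
  · intro h
    have h : U ⊔ F ∙ x = U ⊔ F ∙ y := congrArg Subtype.val h
    exact hyx (h ▸ hself y)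
  · intro h
    have h : U ⊔ F ∙ x = U ⊔ F ∙ (x + y) := congrArg Subtype.val h
    exact hxy (h ▸ hself (x + y))
  · intro h
    have h : U ⊔ F ∙ y = U ⊔ F ∙ (x + y) := congrArg Subtype.val h
    have h1 : x + y ∈ U ⊔ F ∙ y := h ▸ hself (x + y)
    have h2 : x ∈ U ⊔ F ∙ y := (Submodule.add_mem_iff_left _ (hself y)).mp h1
    have h3 : U ⊔ F ∙ x ≤ U ⊔ F ∙ y :=
      sup_le le_sup_left ((Submodule.span_singleton_le_iff_mem _ _).mpr h2)
    have h4 := Submodule.eq_of_le_of_finrank_eq h3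
      (by rw [hx, Submodule.finrank_sup_span_singleton hyU])
    exact hyx (h4 ▸ hself y)

/-- A Schubert variety which is not a point contains a line. -/
theorem exists_lineSet_subset_schubertVariety {k : ℕ} {α : Fin (k + 1) → ℕ}
    (hα : α ∈ indexSet (k + 1) m) (hα' : α ≠ fun i : Fin (k + 1) => (i : ℕ) + 1)
    {A : Fin (k + 1) → Submodule F V} (hA : IsPartialFlag α A) :
    ∃ U W : Submodule F V, U ≤ W ∧ finrank F U = k ∧ finrank F W = k + 2 ∧
      lineSet (k + 1) U W ⊆ schubertVariety A := by
  have hlow : ∀ i : Fin (k + 1), (i : ℕ) + 1 ≤ α i := by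
    intro i
    induction i using Fin.induction with
    | zero => exact (hα.2 0).1
    | succ i ih =>
      have := hα.1 (Fin.castSucc_lt_succ (i := i))
      simp only [Fin.val_castSucc, Fin.val_succ] at ih ⊢
      omega
  -- If the last entry were k + 1, strict increase would push every entry down to its minimum.
  have hlast : k + 2 ≤ α (Fin.last k) := by
    by_contra! hlt
    apply hα'
    funext i
    refine le_antisymm ?_ (hlow i)
    induction i using Fin.reverseInduction with
    | last => simp only [Fin.val_last]; omega
    | cast i ih =>
      have := hα.1 (Fin.castSucc_lt_succ (i := i))
      simp only [Fin.val_castSucc, Fin.val_succ] at ih ⊢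
      omega
  obtain ⟨U, hUA, hUk, hUi⟩ := exists_le_flag k (fun i => A i.castSucc)
    (fun i j hij => hA.1 (by simpa using hij))
    (fun i => by rw [hA.2]; exact hlow i.castSucc) (A (Fin.last k)) (fun i => hA.1 (Fin.le_last _))
  have hdim := hA.2 (Fin.last k)
  obtain ⟨x, hxA, hxU⟩ := exists_mem_notMem_of_finrank_lt (P := U) (Q := A (Fin.last k))
    (by omega)
  have hx := Submodule.finrank_sup_span_singleton hxU
  obtain ⟨y, hyA, hyx⟩ := exists_mem_notMem_of_finrank_lt (P := U ⊔ F ∙ x)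
    (Q := A (Fin.last k)) (by omega)
  have hy := Submodule.finrank_sup_span_singleton hyx
  have hWA : U ⊔ F ∙ x ⊔ F ∙ y ≤ A (Fin.last k) :=
    sup_le (sup_le hUA ((Submodule.span_singleton_le_iff_mem _ _).mpr hxA))
      ((Submodule.span_singleton_le_iff_mem _ _).mpr hyA)
  refine ⟨U, U ⊔ F ∙ x ⊔ F ∙ y, le_sup_left.trans le_sup_left, hUk, by omega, ?_⟩
  -- U already meets the first k conditions; W inside the last flag member settles the remaining
  -- one.
  intro P hP i
  induction i using Fin.lastCases with
  | last =>
    rw [inf_eq_left.mpr (hP.2.trans hWA), P.2]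
    simp
  | cast i => exact (hUi i).trans (Submodule.finrank_mono (inf_le_inf_right _ hP.1))

end Existence

end SchubertCode

/-! ### The main theorem. -/

theorem theorem3p3 {F V : Type*} [Field F] [Finite F] [DecidableEq F]
    [AddCommGroup V] [Module F V] [FiniteDimensional F V]
    (ℓ m : ℕ) (hℓ : 1 ≤ ℓ) (hℓm : ℓ ≤ m)
    (B : Module.Basis (Fin m) F V)
    (b : (P : SchubertCode.Gr F V ℓ) → Module.Basis (Fin ℓ) F P.1)
    (α : Fin ℓ → ℕ) (hα : α ∈ SchubertCode.indexSet ℓ m)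
    (hα' : α ≠ fun i : Fin ℓ => (i : ℕ) + 1)
    (A : Fin ℓ → Submodule F V) (hA : SchubertCode.IsPartialFlag α A) :
    -- the dual Schubert code has minimum distance three
    SchubertCode.HasMinDistance
      (SchubertCode.dualCode (SchubertCode.schubertCode B b A)) 3 ∧
    -- the support of each codeword of weight three lies on a line in the Schubert variety
    (∀ ω ∈ SchubertCode.dualCode (SchubertCode.schubertCode B b A), hammingNorm ω = 3 →
      ∃ U W : Submodule F V, U ≤ W ∧ Module.finrank F U + 1 = ℓ ∧ Module.finrank F W = ℓ + 1 ∧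
        SchubertCode.IsProjectiveLine
          (SchubertCode.plucker B b '' SchubertCode.lineSet ℓ U W) ∧
        SchubertCode.lineSet ℓ U W ⊆ SchubertCode.schubertVariety A ∧
        ∀ P ∈ Function.support ω, P.1 ∈ SchubertCode.lineSet ℓ U W) ∧
    -- any three points of a line in the Schubert variety are the support of a dual codeword
    (∀ U W : Submodule F V, U ≤ W → Module.finrank F U + 1 = ℓ → Module.finrank F W = ℓ + 1 →
      SchubertCode.lineSet ℓ U W ⊆ SchubertCode.schubertVariety A →
      ∀ P Q R : SchubertCode.schubertVariety A,
        P.1 ∈ SchubertCode.lineSet ℓ U W → Q.1 ∈ SchubertCode.lineSet ℓ U W →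
        R.1 ∈ SchubertCode.lineSet ℓ U W → P ≠ Q → P ≠ R → Q ≠ R →
        ∃ ω ∈ SchubertCode.dualCode (SchubertCode.schubertCode B b A),
          Function.support ω = {P, Q, R}) := by
  refine ⟨⟨?_, ?_⟩, ?_, ?_⟩
  · obtain ⟨k, rfl⟩ : ∃ k, ℓ = k + 1 := ⟨ℓ - 1, by omega⟩
    obtain ⟨U, W, hUW, hU, hW, hL⟩ :=
      SchubertCode.exists_lineSet_subset_schubertVariety hα hα' hA
    have hU' : Module.finrank F U + 1 = k + 1 := by rw [hU]
    obtain ⟨P, hP, Q, hQ, R, hR, hPQ, hPR, hQR⟩ :=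
      SchubertCode.exists_three_mem_lineSet hUW hU' hW
    have hne : ∀ {X Y : SchubertCode.Gr F V (k + 1)} (hX : X ∈ SchubertCode.schubertVariety A)
        (hY : Y ∈ SchubertCode.schubertVariety A), X ≠ Y →
        (⟨X, hX⟩ : SchubertCode.schubertVariety A) ≠ ⟨Y, hY⟩ :=
      fun _ _ h h' => h (congrArg Subtype.val h')
    obtain ⟨ω, hω, hsupp⟩ := SchubertCode.exists_mem_dualCode_support_eq B b A hUW hU' hW
      (P := ⟨P, hL hP⟩) (Q := ⟨Q, hL hQ⟩) (R := ⟨R, hL hR⟩) hP hQ hR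
      (hne _ _ hPQ) (hne _ _ hPR) (hne _ _ hQR)
    have hmem := fun X => Set.ext_iff.mp hsupp X
    -- Distance 3 is realized between ω and the zero word.
    refine ⟨ω, hω, 0, Submodule.zero_mem _, ?_, ?_⟩
    · rintro rfl
      simpa using hmem ⟨P, hL hP⟩
    · classical
      rw [hammingDist_zero_right]
      refine Finset.card_eq_three.mpr ⟨⟨P, hL hP⟩, ⟨Q, hL hQ⟩, ⟨R, hL hR⟩,
        hne _ _ hPQ, hne _ _ hPR, hne _ _ hQR, ?_⟩
      ext X
      simpa using hmem X
  · rintro n ⟨x, hx, y, hy, hxy, rfl⟩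
    rw [hammingDist_eq_hammingNorm]
    exact SchubertCode.three_le_hammingNorm B b A (Submodule.add_mem _ (Submodule.neg_mem _ hx) hy)
      (fun h => hxy (neg_add_eq_zero.mp h))
  · intro ω hω h3
    classical
    obtain ⟨P, Q, R, hPQ, hPR, hQR, hs⟩ := Finset.card_eq_three.mp h3
    have hsupp : ∀ X, ω X ≠ 0 ↔ X = P ∨ X = Q ∨ X = R := fun X => by
      simpa using Finset.ext_iff.mp hs X
    obtain ⟨hU, hW, hR⟩ := SchubertCode.exists_line_of_support_eq B b A hω hPQ hPR hQR hsupp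
    have hUW : P.1.1 ⊓ Q.1.1 ≤ P.1.1 ⊔ Q.1.1 := inf_le_left.trans le_sup_left
    have hP : P.1 ∈ SchubertCode.lineSet ℓ (P.1.1 ⊓ Q.1.1) (P.1.1 ⊔ Q.1.1) :=
      ⟨inf_le_left, le_sup_left⟩
    have hQ : Q.1 ∈ SchubertCode.lineSet ℓ (P.1.1 ⊓ Q.1.1) (P.1.1 ⊔ Q.1.1) :=
      ⟨inf_le_right, le_sup_right⟩
    refine ⟨_, _, hUW, hU, hW, SchubertCode.isProjectiveLine_image_lineSet B b hUW hU hW,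
      SchubertCode.lineSet_subset_schubertVariety A hW hP hQ rfl P.2 Q.2, fun X hX => ?_⟩
    rcases (hsupp X).mp hX with rfl | rfl | rfl
    exacts [hP, hQ, hR]
  · intro U W hUW hU hW _ P Q R hP hQ hR hPQ hPR hQR
    exact SchubertCode.exists_mem_dualCode_support_eq B b A hUW hU hW hP hQ hR hPQ hPR hQR
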